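/- Let $\Gamma$ be a weighted digraph without loops on the vertex set $\{1,\dots,n\}$, $n>1$, with strictly positive real arc weights; let $w_{ij}$ be the weight of the arc from $i$ to $j$, with $w_{ij}=0$ if there is no such arc. Let $L=(\ell_{ij})$ be the Laplacian matrix of $\Gamma$: $\ell_{ij}=-w_{ij}$ for $j\ne i$ and $\ell_{ii}=\sum_{k\ne i}w_{ik}$. An in-forest of $\Gamma$ is a spanning subgraph of $\Gamma$ each of whose weak components is a converging tree, that is, has one vertex (the root) of outdegree $0$ while all its other vertices have outdegree $1$. The weight of a subgraph is the product of the weights of its arcs (equal to $1$ if there are no arcs). For $k\ge 0$ let $Q_k$ be the $n\times n$ matrix whose $(i,j)$ entry is the sum of the weights of all in-forests of $\Gamma$ with exactly $k$ arcs in which $i$ belongs to a tree with root $j$. Let $d$ be the minimum number of trees in an in-forest of $\Gamma$, and for $\tau\in\mathbb{C}$ put $$Q(\tau)=\sum_{k=0}^{n-d}\tau^k Q_k .$$ If $\lambda_i\ne 0$ is a (possibly complex) eigenvalue of $L$, then every nonzero column of $Q(-\lambda_i^{-1})$ is an eigenvector of $L$ corresponding to the eigenvalue $\lambda_i$. -/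

import Mathlib

/-- A weighted digraph without loops (and without multiple arcs) on the vertex set `V`: every arc
has a strictly positive real weight, and `weight i j = 0` iff there is no arc from `i` to `j`. -/
structure WeightedDigraph (V : Type*) extends Digraph V where
  weight : V → V → ℝ
  loopless : ∀ i, ¬ Adj i i
  weight_pos : ∀ i j, Adj i j → 0 < weight i j
  weight_eq_zero : ∀ i j, ¬ Adj i j → weight i j = 0

namespace WeightedDigraph

variable {V : Type*}

/-- The undirected graph underlying the digraph on `V` with arc set `F`. A spanning subgraph of a
digraph is given by its set of arcs. -/
def underlying (F : Finset (V × V)) : SimpleGraph V :=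
  SimpleGraph.fromRel (fun u v => (u, v) ∈ F)

open Classical in
/-- The outdegree of `v` in the digraph with arc set `F`: the number of arcs that come from `v`. -/
noncomputable def outdegree (F : Finset (V × V)) (v : V) : ℕ :=
  (F.filter (fun a => a.1 = v)).card

/-- The digraph on `V` with arc set `F` is a converging forest: every weak component is a
converging tree, i.e. one of its vertices (the root) has outdegree zero and all its other vertices
have outdegree one. -/
def IsConvergingForest (F : Finset (V × V)) : Prop :=
  ∀ C : (underlying F).ConnectedComponent, ∃ r ∈ C.supp,
    outdegree F r = 0 ∧ ∀ v ∈ C.supp, v ≠ r → outdegree F v = 1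

/-- In the converging forest with arc set `F`, the vertex `i` belongs to a tree converging to
(rooted at) `j`. -/
def ConvergesTo (F : Finset (V × V)) (i j : V) : Prop :=
  (underlying F).Reachable i j ∧ outdegree F j = 0

/-- The number of trees (weak components) of the forest with arc set `F`. -/
noncomputable def treeCount (F : Finset (V × V)) : ℕ :=
  Nat.card (underlying F).ConnectedComponent

variable [Fintype V] (Γ : WeightedDigraph V)

open Classical in
/-- The set of arcs of `Γ`. -/
noncomputable def arcs : Finset (V × V) :=
  Finset.univ.filter (fun a => Γ.Adj a.1 a.2)

/-- The weight of a subgraph with arc set `F`: the product of the weights of its arcs. -/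
noncomputable def subgraphWeight (F : Finset (V × V)) : ℝ :=
  ∏ a ∈ F, Γ.weight a.1 a.2

/-- The weight of a set of spanning subgraphs: the sum of their weights. -/
noncomputable def familyWeight (𝓖 : Finset (Finset (V × V))) : ℝ :=
  ∑ F ∈ 𝓖, Γ.subgraphWeight F

open Classical in
/-- The set of all in-forests of `Γ`, i.e. of its spanning converging forests. -/
noncomputable def inForests : Finset (Finset (V × V)) :=
  Γ.arcs.powerset.filter (fun F => IsConvergingForest F)

open Classical in
/-- The set of in-forests of `Γ` with `k` arcs in which `i` belongs to a tree converging to `j`. -/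
noncomputable def inForestsTo (k : ℕ) (i j : V) : Finset (Finset (V × V)) :=
  Γ.inForests.filter (fun F => F.card = k ∧ ConvergesTo F i j)

/-- The in-forest dimension `d` of `Γ`: the minimum number of trees in an in-forest of `Γ`. -/
noncomputable def inForestDim : ℕ :=
  sInf {m : ℕ | ∃ F ∈ Γ.inForests, treeCount F = m}

/-- The matrix `Q_k` of in-forests of `Γ` with `k` arcs. -/
noncomputable def forestMatrix (k : ℕ) : Matrix V V ℝ :=
  Matrix.of fun i j => Γ.familyWeight (Γ.inForestsTo k i j)

/-- The parametric matrix of in-forests `Q(τ) = ∑_{k = 0}^{n - d} τ ^ k Q_k`, for complex `τ`. -/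
noncomputable def forestMatrixParam (τ : ℂ) : Matrix V V ℂ :=
  ∑ k ∈ Finset.range (Fintype.card V - Γ.inForestDim + 1),
    τ ^ k • (Γ.forestMatrix k).map Complex.ofReal

/-- The (row) Laplacian matrix of `Γ`: the off-diagonal entries are `-w_{ij}`, and the row sums
are zero. -/
noncomputable def laplacian [DecidableEq V] : Matrix V V ℝ :=
  Matrix.of fun i j =>
    if i = j then ∑ k ∈ Finset.univ.erase i, Γ.weight i k else -Γ.weight i j

end WeightedDigraph

/-! The heart is the identity `(1 + τ L) Q(τ) = σ(τ) I`, where `σ(τ)` is the total weight of all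
in-forests after scaling every arc by `τ`. At `τ = -μ⁻¹` the left factor kills an eigenvector for
`μ`, so it is singular and `σ(τ) = 0`; then `L Q = μ Q`, column by column.

The identity is proved one row `i` at a time. Deleting the arc out of `i`, if any, groups the
in-forests by a forest `G` in which `i` is a root (`sum_inForests_eq`). Restoring an arc `(i, m)`
sends the tree of `i` to the root of `m` and leaves other trees alone (`convergesTo_insert_iff`), so
each `G` contributes an elementary identity. -/

namespace WeightedDigraph

/-! ### Converging forests through directed paths -/

section Forest

variable {V : Type*} {F G : Finset (V × V)}

/-- There is a directed path from `u` to `v` in the digraph with arc set `F`. -/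
def Leads (F : Finset (V × V)) : V → V → Prop :=
  Relation.ReflTransGen fun u v => (u, v) ∈ F

/-- The vertex `v` is the tail of no arc of `F`. -/
def IsRoot (F : Finset (V × V)) (v : V) : Prop := ∀ w, (v, w) ∉ F

/-- Every vertex is the tail of at most one arc of `F`. -/
def IsFunctional (F : Finset (V × V)) : Prop :=
  ∀ ⦃u v w⦄, (u, v) ∈ F → (u, w) ∈ F → v = w

theorem outdegree_eq_zero_iff (v : V) : outdegree F v = 0 ↔ IsRoot F v := by
  classical
  simp only [outdegree, Finset.card_eq_zero, Finset.filter_eq_empty_iff, IsRoot, Prod.forall]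
  constructor
  · intro h w hw
    exact h v w hw rfl
  · rintro h a b hab rfl
    exact h b hab

theorem outdegree_le_one_iff (v : V) :
    outdegree F v ≤ 1 ↔ ∀ ⦃a b⦄, (v, a) ∈ F → (v, b) ∈ F → a = b := by
  classical
  simp only [outdegree, Finset.card_le_one, Finset.mem_filter, Prod.forall, Prod.mk.injEq]
  constructor
  · intro h a b ha hb
    exact (h v a ⟨ha, rfl⟩ v b ⟨hb, rfl⟩).2
  · rintro h a b ⟨hab, rfl⟩ c d ⟨hcd, rfl⟩
    exact ⟨rfl, h hab hcd⟩

theorem IsRoot.mono (hGF : G ⊆ F) {v : V} (h : IsRoot F v) : IsRoot G v :=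
  fun w hw => h w (hGF hw)

theorem Leads.mono (hGF : G ⊆ F) {u v : V} (h : Leads G u v) : Leads F u v :=
  Relation.ReflTransGen.mono (fun _ _ hab => hGF hab) _ _ h

theorem IsRoot.eq_of_leads {u v : V} (hu : IsRoot F u) (h : Leads F u v) : u = v := by
  rcases h.cases_head with h | ⟨w, hw, -⟩
  · exact h
  · exact absurd hw (hu w)

theorem IsFunctional.leads_of_leads (hF : IsFunctional F) {u v r : V} (huv : (u, v) ∈ F)
    (hr : IsRoot F r) (h : Leads F u r) : Leads F v r := by
  rcases h.cases_head with rfl | ⟨w, hw, hwr⟩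
  · exact absurd huv (hr v)
  · rwa [hF huv hw]

theorem IsFunctional.root_unique (hF : IsFunctional F) {v r s : V} (hr : IsRoot F r)
    (hs : IsRoot F s) (hvr : Leads F v r) (hvs : Leads F v s) : r = s := by
  induction hvr using Relation.ReflTransGen.head_induction_on with
  | refl => exact hr.eq_of_leads hvs
  | head h _ ih => exact ih (hF.leads_of_leads h hs hvs)

theorem Leads.reachable {u v : V} (h : Leads F u v) : (underlying F).Reachable u v := by
  induction h with
  | refl => exact SimpleGraph.Reachable.refl _
  | @tail b c _ hbc ih =>
    by_cases hne : b = c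
    · exact hne ▸ ih
    · refine ih.trans (SimpleGraph.Adj.reachable ?_)
      simp only [underlying, SimpleGraph.fromRel_adj]
      exact ⟨hne, Or.inl hbc⟩

/-- In a functional digraph, leading to a given root is invariant along weak components. -/
theorem leads_of_reachable {u r : V} (hr : IsRoot F r)
    (hF : ∀ u, (underlying F).Reachable u r → ∀ ⦃a b⦄, (u, a) ∈ F → (u, b) ∈ F → a = b)
    (h : (underlying F).Reachable u r) : Leads F u r := by
  obtain ⟨p⟩ := h
  induction p with
  | nil => exact Relation.ReflTransGen.refl
  | @cons u v w huv p ih =>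
    have hv := ih hr hF
    simp only [underlying, SimpleGraph.fromRel_adj] at huv
    rcases huv.2 with h | h
    · exact Relation.ReflTransGen.head h hv
    -- The arc points from `v` back to `u`, so the path from `v` to the root must begin with it.
    · rcases hv.cases_head with rfl | ⟨x, hx, hxw⟩
      · exact absurd h (hr u)
      · rwa [hF v ⟨p⟩ h hx]

/-- Replaces weak components by directed paths: with at most one arc out of each vertex, the only
obstruction to being a forest is a cycle, from which no root is reached. -/
theorem isConvergingForest_iff :
    IsConvergingForest F ↔ IsFunctional F ∧ ∀ v, ∃ r, IsRoot F r ∧ Leads F v r := by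
  constructor
  · intro h
    have hF : IsFunctional F := by
      intro u v w
      obtain ⟨r, -, hr0, hr1⟩ := h ((underlying F).connectedComponentMk u)
      suffices h1 : outdegree F u ≤ 1 from fun hv hw => (outdegree_le_one_iff u).1 h1 hv hw
      by_cases hur : u = r
      · rw [hur, hr0]
        exact zero_le_one
      · exact (hr1 u rfl hur).le
    refine ⟨hF, fun v => ?_⟩
    obtain ⟨r, hrC, hr0, -⟩ := h ((underlying F).connectedComponentMk v)
    have hr := (outdegree_eq_zero_iff r).1 hr0
    exact ⟨r, hr, leads_of_reachable hr (fun u _ _ _ => @hF u _ _)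
      (SimpleGraph.ConnectedComponent.exact hrC).symm⟩
  · rintro ⟨hF, h⟩ C
    induction C using SimpleGraph.ConnectedComponent.ind with
    | h v =>
      obtain ⟨r, hr, hvr⟩ := h v
      refine ⟨r, SimpleGraph.ConnectedComponent.sound hvr.reachable.symm,
        (outdegree_eq_zero_iff r).2 hr, fun u hu hur => ?_⟩
      have hur' : Leads F u r := leads_of_reachable hr (fun u _ _ _ => @hF u _ _)
        ((SimpleGraph.ConnectedComponent.exact hu).trans hvr.reachable)
      have h1 : outdegree F u ≤ 1 := (outdegree_le_one_iff u).2 (@hF u)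
      have h0 : outdegree F u ≠ 0 := fun h0 =>
        hur (((outdegree_eq_zero_iff u).1 h0).eq_of_leads hur')
      omega

theorem IsConvergingForest.isFunctional (h : IsConvergingForest F) : IsFunctional F :=
  (isConvergingForest_iff.1 h).1

theorem IsConvergingForest.convergesTo_iff (h : IsConvergingForest F) {i j : V} :
    ConvergesTo F i j ↔ IsRoot F j ∧ Leads F i j := by
  rw [ConvergesTo, outdegree_eq_zero_iff]
  constructor
  · rintro ⟨hij, hj⟩
    exact ⟨hj, leads_of_reachable hj (fun _ _ _ _ ha hb => h.isFunctional ha hb) hij⟩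
  · rintro ⟨hj, hij⟩
    exact ⟨hij.reachable, hj⟩

theorem IsConvergingForest.exists_convergesTo (h : IsConvergingForest F) (v : V) :
    ∃ r, ConvergesTo F v r := by
  obtain ⟨r, hr⟩ := (isConvergingForest_iff.1 h).2 v
  exact ⟨r, h.convergesTo_iff.2 hr⟩

theorem IsConvergingForest.convergesTo_unique (h : IsConvergingForest F) {v r s : V}
    (hr : ConvergesTo F v r) (hs : ConvergesTo F v s) : r = s := by
  rw [h.convergesTo_iff] at hr hs
  exact h.isFunctional.root_unique hr.1 hs.1 hr.2 hs.2

theorem IsConvergingForest.convergesTo_iff_eq (h : IsConvergingForest F) {v r s : V}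
    (hr : ConvergesTo F v r) : ConvergesTo F v s ↔ r = s :=
  ⟨h.convergesTo_unique hr, fun e => e ▸ hr⟩

theorem convergesTo_self {i : V} (hi : IsRoot F i) : ConvergesTo F i i :=
  ⟨SimpleGraph.Reachable.refl _, (outdegree_eq_zero_iff i).2 hi⟩

/-! ### Adding and deleting the arc out of a vertex -/

section Insert

variable [DecidableEq V] {i m : V}

theorem IsRoot.insert {r : V} (hr : IsRoot G r) (hri : r ≠ i) :
    IsRoot (insert (i, m) G) r := by
  intro w hw
  rcases Finset.mem_insert.1 hw with h | h
  · exact hri (Prod.mk.inj h).1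
  · exact hr w h

theorem IsConvergingForest.insert_root (hG : IsConvergingForest G)
    (hm : ¬ ConvergesTo G m i) (v : V) :
    ∃ r, (IsRoot (insert (i, m) G) r ∧ Leads (insert (i, m) G) v r) ∧
      ConvergesTo G (open Classical in if ConvergesTo G v i then m else v) r := by
  have hsub : G ⊆ insert (i, m) G := Finset.subset_insert _ _
  by_cases hv : ConvergesTo G v i
  · obtain ⟨r, hr⟩ := hG.exists_convergesTo m
    have hr' := hG.convergesTo_iff.1 hr
    have hri : r ≠ i := fun e => hm (e ▸ hr)
    refine ⟨r, ⟨hr'.1.insert hri, ?_⟩, by rwa [if_pos hv]⟩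
    exact ((hG.convergesTo_iff.1 hv).2.mono hsub).trans
      (Relation.ReflTransGen.head (Finset.mem_insert_self _ _) (hr'.2.mono hsub))
  · obtain ⟨r, hr⟩ := hG.exists_convergesTo v
    have hr' := hG.convergesTo_iff.1 hr
    have hri : r ≠ i := fun e => hv (e ▸ hr)
    exact ⟨r, ⟨hr'.1.insert hri, hr'.2.mono hsub⟩, by rwa [if_neg hv]⟩

theorem IsConvergingForest.insert (hG : IsConvergingForest G) (hi : IsRoot G i)
    (hm : ¬ ConvergesTo G m i) : IsConvergingForest (insert (i, m) G) := by
  refine isConvergingForest_iff.2 ⟨?_, fun v => ?_⟩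
  · intro u v w hv hw
    rcases Finset.mem_insert.1 hv with hv | hv <;> rcases Finset.mem_insert.1 hw with hw | hw
    · exact (Prod.mk.inj hv).2.trans (Prod.mk.inj hw).2.symm
    · exact absurd ((Prod.mk.inj hv).1 ▸ hw) (hi w)
    · exact absurd ((Prod.mk.inj hw).1 ▸ hv) (hi v)
    · exact hG.isFunctional hv hw
  · obtain ⟨r, hr, -⟩ := hG.insert_root hm v
    exact ⟨r, hr⟩

open Classical in
theorem IsConvergingForest.convergesTo_insert_iff (hG : IsConvergingForest G) (hi : IsRoot G i)
    (hm : ¬ ConvergesTo G m i) (v j : V) :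
    ConvergesTo (Insert.insert (i, m) G) v j ↔
      ConvergesTo G (if ConvergesTo G v i then m else v) j := by
  obtain ⟨r, hr, hr'⟩ := hG.insert_root hm v
  have hH := hG.insert hi hm
  rw [hH.convergesTo_iff_eq (hH.convergesTo_iff.2 hr), hG.convergesTo_iff_eq hr']

theorem IsConvergingForest.isRoot_erase (hF : IsConvergingForest F) (him : (i, m) ∈ F) :
    IsRoot (F.erase (i, m)) i := by
  intro w hw
  rw [Finset.mem_erase] at hw
  exact hw.1 (by rw [hF.isFunctional hw.2 him])

theorem IsConvergingForest.erase (hF : IsConvergingForest F) (him : (i, m) ∈ F) :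
    IsConvergingForest (F.erase (i, m)) := by
  refine isConvergingForest_iff.2 ⟨fun u v w hv hw =>
    hF.isFunctional (Finset.mem_of_mem_erase hv) (Finset.mem_of_mem_erase hw), fun v => ?_⟩
  obtain ⟨r, hr, hvr⟩ := (isConvergingForest_iff.1 hF).2 v
  induction hvr using Relation.ReflTransGen.head_induction_on with
  | refl => exact ⟨r, hr.mono (Finset.erase_subset _ _), Relation.ReflTransGen.refl⟩
  | @head a c hac _ ih =>
    by_cases hai : a = i
    · exact ⟨i, hF.isRoot_erase him, hai ▸ Relation.ReflTransGen.refl⟩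
    · obtain ⟨s, hs, hcs⟩ := ih
      refine ⟨s, hs, Relation.ReflTransGen.head (Finset.mem_erase.2 ⟨?_, hac⟩) hcs⟩
      exact fun e => hai (Prod.mk.inj e).1

/-- Otherwise restoring the arc would close a cycle: everything that `m` leads to in `F`, its root
included, would still lead to `i`, forcing that root to be `i`, which has an outgoing arc. -/
theorem IsConvergingForest.not_convergesTo_erase (hF : IsConvergingForest F)
    (him : (i, m) ∈ F) : ¬ ConvergesTo (F.erase (i, m)) m i := by
  intro hmi
  have hG := hF.erase him
  have key : ∀ v, Leads F m v → Leads (F.erase (i, m)) v i := by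
    intro v hv
    induction hv with
    | refl => exact (hG.convergesTo_iff.1 hmi).2
    | @tail b c _ hbc ih =>
      by_cases h : (b, c) = (i, m)
      · rw [(Prod.mk.inj h).2]
        exact (hG.convergesTo_iff.1 hmi).2
      · exact hG.isFunctional.leads_of_leads (Finset.mem_erase.2 ⟨h, hbc⟩)
          (hF.isRoot_erase him) ih
  obtain ⟨r, hr, hmr⟩ := (isConvergingForest_iff.1 hF).2 m
  have := hr.eq_of_leads ((key r hmr).mono (Finset.erase_subset _ _))
  exact hr m (this ▸ him)

end Insert

/-- Arcs inject into non-roots by their tails, and every tree contains a root. Hence no in-forest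
has more than `n - d` arcs. -/
theorem IsConvergingForest.card_add_treeCount_le [Fintype V] (hF : IsConvergingForest F) :
    F.card + treeCount F ≤ Fintype.card V := by
  classical
  set R : Finset V := Finset.univ.filter (IsRoot F)
  have h1 : F.card ≤ Rᶜ.card := by
    refine Finset.card_le_card_of_injOn Prod.fst ?_ ?_
    · intro a ha
      simp only [Finset.coe_compl, Set.mem_compl_iff, Finset.mem_coe, R, Finset.mem_filter,
        Finset.mem_univ, true_and]
      exact fun h => h a.2 ha
    · rintro ⟨a, b⟩ hab ⟨c, d⟩ hcd (rfl : a = c)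
      rw [hF.isFunctional hab hcd]
  have h2 : treeCount F ≤ R.card := by
    have hsurj : Function.Surjective
        fun r : R => (underlying F).connectedComponentMk r.1 := by
      intro C
      induction C using SimpleGraph.ConnectedComponent.ind with
      | h v =>
        obtain ⟨r, hr, hvr⟩ := (isConvergingForest_iff.1 hF).2 v
        exact ⟨⟨r, by simpa [R] using hr⟩,
          SimpleGraph.ConnectedComponent.sound hvr.reachable.symm⟩
    rw [treeCount, ← Nat.card_eq_finsetCard R]
    exact Nat.card_le_card_of_surjective _ hsurj
  rw [Finset.card_compl] at h1
  have := R.card_le_univ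
  omega

end Forest

/-! ### The parametric matrix-forest theorem -/

section Matrix

variable {V : Type*} (Γ : WeightedDigraph V)

/-- The product of the arc weights of `F`, each multiplied by `τ`. -/
noncomputable def scaledWeight (τ : ℂ) (F : Finset (V × V)) : ℂ :=
  ∏ a ∈ F, τ * (Γ.weight a.1 a.2 : ℂ)

theorem scaledWeight_insert [DecidableEq V] (τ : ℂ) {i m : V} {G : Finset (V × V)} (hi : IsRoot G i) :
    Γ.scaledWeight τ (insert (i, m) G) = τ * Γ.weight i m * Γ.scaledWeight τ G := by
  rw [scaledWeight, Finset.prod_insert (hi m)]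
  rfl

variable [Fintype V]

theorem mem_inForests {F : Finset (V × V)} :
    F ∈ Γ.inForests ↔ (∀ a ∈ F, Γ.Adj a.1 a.2) ∧ IsConvergingForest F := by
  classical
  simp [inForests, arcs, Finset.subset_iff]

theorem card_le_of_mem_inForests {F : Finset (V × V)} (hF : F ∈ Γ.inForests) :
    F.card ≤ Fintype.card V - Γ.inForestDim := by
  have h1 := ((Γ.mem_inForests).1 hF).2.card_add_treeCount_le
  have h2 : Γ.inForestDim ≤ treeCount F := Nat.sInf_le ⟨F, hF, rfl⟩
  omega

-- The cutoff at `n - d` omits no in-forest, so the powers of `τ` can be absorbed into the arc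
-- weights.
open Classical in
theorem forestMatrixParam_apply (τ : ℂ) (i j : V) :
    Γ.forestMatrixParam τ i j =
      ∑ F ∈ Γ.inForests, if ConvergesTo F i j then Γ.scaledWeight τ F else 0 := by
  simp only [forestMatrixParam, Matrix.sum_apply, Matrix.smul_apply, Matrix.map_apply,
    forestMatrix, Matrix.of_apply, familyWeight, inForestsTo, subgraphWeight, smul_eq_mul,
    Complex.ofReal_sum, Finset.sum_filter, Finset.mul_sum, scaledWeight,
    Finset.prod_mul_distrib, Finset.prod_const]
  rw [Finset.sum_comm]
  refine Finset.sum_congr rfl fun F hF => ?_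
  rw [Finset.sum_eq_single_of_mem F.card]
  · by_cases h : ConvergesTo F i j <;> simp [h]
  · exact Finset.mem_range.2 (Nat.lt_succ_of_le (Γ.card_le_of_mem_inForests hF))
  · intro k _ hk
    rw [if_neg fun h => hk h.1.symm, Complex.ofReal_zero, mul_zero]

open Classical in
/-- The in-forests in which `i` is a root. -/
noncomputable def inForestsRootedAt (i : V) : Finset (Finset (V × V)) :=
  Γ.inForests.filter fun F => IsRoot F i

open Classical in
/-- The heads of the arcs from `i` that can be added to a forest `G` in which `i` is a root. -/
noncomputable def admissibleHeads (i : V) (G : Finset (V × V)) : Finset V :=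
  Finset.univ.filter fun m => Γ.Adj i m ∧ ¬ ConvergesTo G m i

variable [DecidableEq V]

/-- Every in-forest arises in a unique way from one in which `i` is a root by adding at most one
arc from `i`. -/
theorem sum_inForests_eq {M : Type*} [AddCommMonoid M] (i : V) (f : Finset (V × V) → M) :
    ∑ F ∈ Γ.inForests, f F =
      ∑ G ∈ Γ.inForestsRootedAt i,
        (f G + ∑ m ∈ Γ.admissibleHeads i G, f (insert (i, m) G)) := by
  classical
  rw [Finset.sum_add_distrib, inForestsRootedAt,
    ← Finset.sum_filter_add_sum_filter_not Γ.inForests (fun F => IsRoot F i)]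
  congr 1
  rw [Finset.sum_sigma']
  symm
  refine Finset.sum_bij (fun x _ => insert (i, x.2) x.1) ?_ ?_ ?_ ?_
  · rintro ⟨G, m⟩ h
    simp only [Finset.mem_sigma, Finset.mem_filter, mem_inForests, admissibleHeads,
      Finset.mem_univ, true_and] at h ⊢
    obtain ⟨⟨⟨hadj, hG⟩, hi⟩, him, hm⟩ := h
    refine ⟨⟨?_, hG.insert hi hm⟩, fun h => h m (Finset.mem_insert_self _ _)⟩
    intro a ha
    rcases Finset.mem_insert.1 ha with rfl | ha
    · exact him
    · exact hadj a ha
  · rintro ⟨G, m⟩ h ⟨G', m'⟩ h' e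
    simp only [Finset.mem_sigma, Finset.mem_filter] at h h' e
    have hm : m = m' := by
      have : (i, m) ∈ insert (i, m') G' := e ▸ Finset.mem_insert_self _ _
      rcases Finset.mem_insert.1 this with h1 | h1
      · exact (Prod.mk.inj h1).2
      · exact absurd h1 (h'.1.2 m)
    subst hm
    have hG : G = G' := by
      rw [← Finset.erase_insert (h.1.2 m), e, Finset.erase_insert (h'.1.2 m)]
    rw [hG]
  · intro F hF
    simp only [Finset.mem_filter, mem_inForests, IsRoot, not_forall, not_not] at hF
    obtain ⟨⟨hadj, hF⟩, m, him⟩ := hF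
    refine ⟨⟨F.erase (i, m), m⟩, ?_, Finset.insert_erase him⟩
    simp only [Finset.mem_sigma, Finset.mem_filter, mem_inForests, admissibleHeads,
      Finset.mem_univ, true_and]
    exact ⟨⟨⟨fun a ha => hadj a (Finset.mem_of_mem_erase ha), hF.erase him⟩,
      hF.isRoot_erase him⟩, hadj _ him, hF.not_convergesTo_erase him⟩
  · intros
    rfl

theorem laplacian_mul_apply (τ : ℂ) (Q : Matrix V V ℂ) (i j : V) :
    ((1 + τ • Γ.laplacian.map Complex.ofReal) * Q) i j =
      Q i j + ∑ m, τ * Γ.weight i m * (Q i j - Q m j) := by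
  have h : (Γ.laplacian.map Complex.ofReal * Q) i j =
      ∑ m, (Γ.weight i m : ℂ) * (Q i j - Q m j) := by
    rw [Matrix.mul_apply, ← Finset.add_sum_erase _ _ (Finset.mem_univ i),
      ← Finset.add_sum_erase (a := i) _ (fun m => (Γ.weight i m : ℂ) * (Q i j - Q m j))
        (Finset.mem_univ i)]
    simp only [laplacian, Matrix.map_apply, Matrix.of_apply, if_true, sub_self, mul_zero, zero_add,
      Complex.ofReal_sum, Finset.sum_mul, mul_sub, Finset.sum_sub_distrib]
    rw [sub_eq_add_neg, ← Finset.sum_neg_distrib]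
    congr 1
    refine Finset.sum_congr rfl fun m hm => ?_
    rw [if_neg (Finset.ne_of_mem_erase hm).symm]
    push_cast
    ring
  rw [add_mul, one_mul, Matrix.smul_mul, Matrix.add_apply, Matrix.smul_apply, h, smul_eq_mul,
    Finset.mul_sum]
  simp only [mul_assoc]

/-- The parametric matrix-forest theorem: `(1 + τ L) Q(τ)` is a scalar matrix, the scalar being
the total weight of all in-forests with arc weights multiplied by `τ`. -/
theorem one_add_smul_laplacian_mul_forestMatrixParam (τ : ℂ) :
    (1 + τ • Γ.laplacian.map Complex.ofReal) * Γ.forestMatrixParam τ =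
      (∑ F ∈ Γ.inForests, Γ.scaledWeight τ F) • (1 : Matrix V V ℂ) := by
  classical
  ext i j
  rw [laplacian_mul_apply, Matrix.smul_apply, Matrix.one_apply, smul_eq_mul]
  simp only [forestMatrixParam_apply, Γ.sum_inForests_eq i]
  simp only [← Finset.sum_sub_distrib, Finset.mul_sum, Finset.sum_mul]
  rw [Finset.sum_comm, ← Finset.sum_add_distrib]
  -- From here the identity is checked for each `G` separately.
  refine Finset.sum_congr rfl fun G hG => ?_
  rw [inForestsRootedAt, Finset.mem_filter, mem_inForests] at hG
  obtain ⟨⟨-, hG⟩, hi⟩ := hG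
  set A := Γ.admissibleHeads i G
  set a : V → ℂ := fun m => τ * Γ.weight i m with ha
  set x : V → ℂ := fun m => if ConvergesTo G m j then 1 else 0 with hx
  set δ : ℂ := if i = j then 1 else 0 with hδ
  have hself : ConvergesTo G i i := convergesTo_self hi
  have hroot : ∀ m, ConvergesTo G m i → x m = δ := fun m hm => by
    simp only [hx, hδ, hG.convergesTo_iff_eq hm]
  set w := Γ.scaledWeight τ G
  set S := ∑ m ∈ A, a m * x m with hS
  set s := ∑ m ∈ A, a m with hs
  have hnot : ∀ m ∈ A, ¬ ConvergesTo G m i := fun m hm => (Finset.mem_filter.1 hm).2.2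
  -- The share of `G` and its one-arc extensions in the entry `(v, j)`: a vertex in the tree of `i`
  -- inherits the root of `m`, any other keeps its own.
  have hQ : ∀ v, ((if ConvergesTo G v j then w else 0) +
      ∑ m ∈ A, if ConvergesTo (insert (i, m) G) v j then Γ.scaledWeight τ (insert (i, m) G)
        else 0) = w * (x v + if ConvergesTo G v i then S else s * x v) := by
    intro v
    have h1 : (if ConvergesTo G v j then w else 0) = w * x v := by simp [hx]
    rw [h1, mul_add]
    congr 1
    have h2 : ∀ m ∈ A, (if ConvergesTo (insert (i, m) G) v j then
        Γ.scaledWeight τ (insert (i, m) G) else 0) =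
        w * (a m * x (if ConvergesTo G v i then m else v)) := by
      intro m hm
      rw [Γ.scaledWeight_insert τ hi]
      simp only [hG.convergesTo_insert_iff hi (hnot m hm), hx, ha]
      split_ifs <;> ring
    rw [Finset.sum_congr rfl h2, ← Finset.mul_sum]
    split_ifs
    · rfl
    · rw [hs, Finset.sum_mul]
  simp only [hQ, if_pos hself, hroot i hself]
  -- Such an `m` lies in the tree of `i`, where the difference vanishes, or is not a head of an arc
  -- from `i`, and its weight is zero.
  have hterm : ∀ m ∉ A, a m * (w * (δ + S) -
      w * (x m + if ConvergesTo G m i then S else s * x m)) = 0 := by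
    intro m hm
    by_cases hmi : ConvergesTo G m i
    · rw [hroot m hmi, if_pos hmi, sub_self, mul_zero]
    · have : ¬ Γ.Adj i m := fun h => hm (Finset.mem_filter.2 ⟨Finset.mem_univ _, h, hmi⟩)
      simp [ha, Γ.weight_eq_zero i m this]
  have hsum : ∑ m, a m * (w * (δ + S) -
      w * (x m + if ConvergesTo G m i then S else s * x m)) = w * (s * δ - S) := by
    rw [← Finset.sum_subset (Finset.subset_univ A) fun m _ hm => hterm m hm]
    have : ∀ m ∈ A, a m * (w * (δ + S) -
        w * (x m + if ConvergesTo G m i then S else s * x m)) =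
        w * (δ + S) * a m - w * (1 + s) * (a m * x m) := by
      intro m hm
      rw [if_neg (hnot m hm)]
      ring
    have hfac : ∀ c (f : V → ℂ), ∑ m ∈ A, c * f m = c * ∑ m ∈ A, f m :=
      fun c f => (Finset.mul_sum A f c).symm
    rw [Finset.sum_congr rfl this, Finset.sum_sub_distrib, hfac _ a, hfac _ fun m => a m * x m,
      ← hS, ← hs]
    ring
  rw [hsum]
  have htot : ∑ m ∈ A, Γ.scaledWeight τ (insert (i, m) G) = w * s := by
    rw [hs, Finset.mul_sum]
    refine Finset.sum_congr rfl fun m _ => ?_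
    rw [Γ.scaledWeight_insert τ hi, mul_comm]
  rw [htot]
  ring

end Matrix

end WeightedDigraph

/-! ### Eigenvectors from the matrix identity -/

theorem proposition13 {V : Type*} [Fintype V] [DecidableEq V] (Γ : WeightedDigraph V)
    (μ : ℂ) (hμ : μ ≠ 0)
    (heig : Module.End.HasEigenvalue (Matrix.toLin' (Γ.laplacian.map Complex.ofReal)) μ)
    (j : V) (hj : (fun i => Γ.forestMatrixParam (-μ⁻¹) i j) ≠ 0) :
    Module.End.HasEigenvector (Matrix.toLin' (Γ.laplacian.map Complex.ofReal)) μ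
      (fun i => Γ.forestMatrixParam (-μ⁻¹) i j) := by
  set L := Γ.laplacian.map Complex.ofReal with hL
  set Q := Γ.forestMatrixParam (-μ⁻¹) with hQ
  have key := Γ.one_add_smul_laplacian_mul_forestMatrixParam (-μ⁻¹)
  rw [← hL, ← hQ] at key
  set s := ∑ F ∈ Γ.inForests, Γ.scaledWeight (-μ⁻¹) F
  have hs : s = 0 := by
    -- A nonzero `s` would make `1 - μ⁻¹ L` invertible, with inverse `s⁻¹ Q`.
    by_contra hs
    obtain ⟨v, hv⟩ := heig.exists_hasEigenvector
    have hLv : L.mulVec v = μ • v := by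
      simpa using hv.apply_eq_smul
    have h1 : (1 + (-μ⁻¹) • L) * (s⁻¹ • Q) = 1 := by
      rw [Matrix.mul_smul, key, smul_smul, inv_mul_cancel₀ hs, one_smul]
    have h2 := mul_eq_one_comm.1 h1
    have h3 : (1 + (-μ⁻¹) • L).mulVec v = 0 := by
      rw [Matrix.add_mulVec, Matrix.one_mulVec, Matrix.smul_mulVec, hLv, smul_smul, neg_mul,
        inv_mul_cancel₀ hμ, neg_smul, one_smul, add_neg_cancel]
    apply hv.2
    rw [← Matrix.one_mulVec v, ← h2, ← Matrix.mulVec_mulVec, h3, Matrix.mulVec_zero]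
  rw [hs, zero_smul, add_mul, one_mul, Matrix.smul_mul] at key
  refine ⟨Module.End.mem_eigenspace_iff.2 ?_, hj⟩
  ext i
  have h := congrFun (congrFun key i) j
  simp only [Matrix.add_apply, Matrix.smul_apply, smul_eq_mul, Matrix.zero_apply] at h
  have h' : (L * Q) i j = μ * Q i j := by
    field_simp at h
    linear_combination -h
  simpa [Matrix.toLin'_apply, Matrix.mulVec, dotProduct, Matrix.mul_apply] using h'
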